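/- Let $d\ge 3$, let $x\in\mathbb{R}^d$, and let $B=\{B(t),t\ge 0\}$ be a standard $d$-dimensional Brownian motion started at $B(0)=x$ (independent increments, $B(t)-B(s)\sim N(0,(t-s)I_d)$ for $0\le s\le t$, and a.s. continuous paths). Let $f:\mathbb{R}^d\to[0,\infty)$ be continuous, bounded and Lebesgue integrable. Then the perpetual integral functional $\int_0^\infty f(B(t))\,dt$ exists (that is, converges) almost surely and is square integrable. Its expectation equals $$E\left[\int_0^\infty f(B(t))\,dt\right]=\frac{2^{d/2-1}\,\Gamma(d/2-1)}{(2\pi)^{d/2}}\int_{\mathbb{R}^d}\frac{f(x+y)}{|y|^{d-2}}\,dy,$$ and its variance equals $$E\left[\left(\int_0^\infty f(B(t))\,dt-E\left[\int_0^\infty f(B(t))\,dt\right]\right)^2\right]=\frac{2^{d-2}\,\Gamma^2(d/2-1)}{(2\pi)^{d}}\left(2\int_{\mathbb{R}^d}\int_{\mathbb{R}^d}\frac{f(x+y)\,f(x+y+z)}{|y|^{d-2}|z|^{d-2}}\,dy\,dz-\left(\int_{\mathbb{R}^d}\frac{f(x+y)}{|y|^{d-2}}\,dy\right)^2\right),$$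 where all the integrals on the right-hand sides converge absolutely. If $f\ne 0$, then $\int_0^\infty f(B(t))\,dt$ is not almost surely equal to a constant; consequently, the right-hand side of the variance formula is strictly positive. -/

import Mathlib

open MeasureTheory ProbabilityTheory
open scoped NNReal

/-- `B` is a standard `d`-dimensional Brownian motion started at the point `x`, on the probability
space `(Ω, P)`: it starts at `x`, it has independent increments, the increment `B t - B s`, `s ≤ t`,
is centered Gaussian with covariance matrix `(t - s) • 1`, and almost all paths are continuous. -/
structure IsBrownianFrom {Ω : Type*} [MeasurableSpace Ω] {d : ℕ}
    (B : ℝ≥0 → Ω → EuclideanSpace ℝ (Fin d)) (x : EuclideanSpace ℝ (Fin d)) (P : Measure Ω) :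
    Prop where
  start : ∀ᵐ ω ∂P, B 0 ω = x
  indep_increments : HasIndepIncrements B P
  law_increments : ∀ s t : ℝ≥0, s ≤ t →
    HasLaw (fun ω => B t ω - B s ω)
      (multivariateGaussian 0 (((t : ℝ) - (s : ℝ)) • (1 : Matrix (Fin d) (Fin d) ℝ))) P
  continuous_paths : ∀ᵐ ω ∂P, Continuous fun t => B t ω

/-- The class `CL(ℝᵈ)` of continuous, bounded functions that belong to `L¹(ℝᵈ)`. -/
structure IsCL {d : ℕ} (f : EuclideanSpace ℝ (Fin d) → ℝ) : Prop where
  continuous : Continuous f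
  bounded : ∃ C : ℝ, ∀ y, |f y| ≤ C
  integrable : Integrable f volume

/-- The perpetual integral functional `∫₀^∞ f (X t) dt` of the process `X`, as a random variable. -/
noncomputable def perpetualIntegral {Ω : Type*} {d : ℕ} (f : EuclideanSpace ℝ (Fin d) → ℝ)
    (X : ℝ≥0 → Ω → EuclideanSpace ℝ (Fin d)) (ω : Ω) : ℝ :=
  ∫ t in Set.Ioi (0 : ℝ), f (X t.toNNReal ω)

/-!
Write `p_t` for the heat kernel and `K(y) = ∫₀^∞ p_t(y) dt = c / |y|^(d-2)` for the Newton kernel; the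
integral converges because `d ≥ 3`. By Tonelli's theorem, the mean of the perpetual integral `I` is
the potential `u(x) = ∫ f(x + y) K(y) dy` of `f` at `x` (`IsBrownianFrom.lintegral_occupation`). The
potential is bounded: the times `t ≤ 1` contribute at most `sup f`, and the times `t > 1` at most
`‖f‖₁ ∫₁^∞ t^(-d/2) dt` (`exists_potential_le`).

Splitting the square `[0, ∞)²` along its diagonal gives `I² = 2 ∫₀^∞ f(B_s) ∫₀^∞ f(B_{s+r}) dr ds`.
The Markov property, in the form
`E[h(B_s) ∫₀^∞ f(B_{s+r}) dr] = E[h(B_s) u(B_s)]` (`IsBrownianFrom.lintegral_eval_mul_future`), then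
turns the second moment into twice the potential of `f u`, which is finite as `u` is bounded. This is
`IsBrownianFrom.lintegral_occupation_sq`.

Suppose that `I = c` almost surely, and that `f ≤ M`. For every `s > 0`, the integral over `(s, ∞)` lies
between `c - s M` and `c`, so by the Markov property `c - s M ≤ u ≤ c` almost everywhere for the law of
`B_s`, which has a positive density; letting `s → 0`, `u = c` Lebesgue-almost everywhere. Hence the
integral over `(1, ∞)` has the same mean `c` as the integral over `(0, ∞)`, so `E f(B_t) = 0` for
almost every `t ∈ (0, 1]`, and `f = 0`
(`IsBrownianFrom.ae_eq_zero_of_occupation_ae_const`).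

These computations are carried out with Lebesgue integrals valued in `ℝ≥0∞`, for a modification of
`B` that is measurable at every time and has only continuous paths
(`IsBrownianFrom.exists_measurable_modification`).
-/

open Set Filter Topology
open scoped ENNReal RealInnerProductSpace

/-! ### The heat kernel and the Newton kernel -/

/-- The Gaussian density `p_t(y) = (2πt)^(-d/2) exp(-|y|²/(2t))`, meaningful for `t > 0`. -/
noncomputable def heatKernel {d : ℕ} (t : ℝ) (y : EuclideanSpace ℝ (Fin d)) : ℝ :=
  (2 * Real.pi * t) ^ (-((d : ℝ) / 2)) * Real.exp (-(‖y‖ ^ 2) / (2 * t))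

lemma heatKernel_nonneg {d : ℕ} {t : ℝ} (ht : 0 ≤ t) (y : EuclideanSpace ℝ (Fin d)) :
    0 ≤ heatKernel t y := by
  have := Real.pi_pos
  unfold heatKernel
  positivity

lemma heatKernel_pos {d : ℕ} {t : ℝ} (ht : 0 < t) (y : EuclideanSpace ℝ (Fin d)) :
    0 < heatKernel t y := by
  have := Real.pi_pos
  unfold heatKernel
  positivity

lemma heatKernel_le {d : ℕ} {t : ℝ} (ht : 0 < t) (y : EuclideanSpace ℝ (Fin d)) :
    heatKernel t y ≤ t ^ (-((d : ℝ) / 2)) := by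
  have hpi := Real.pi_gt_three
  unfold heatKernel
  have h1 : (2 * Real.pi * t) ^ (-((d : ℝ) / 2)) ≤ t ^ (-((d : ℝ) / 2)) := by
    apply Real.rpow_le_rpow_of_nonpos ht
    · nlinarith
    · have : (0 : ℝ) ≤ d := by positivity
      linarith
  have h2 : Real.exp (-(‖y‖ ^ 2) / (2 * t)) ≤ 1 := by
    rw [Real.exp_le_one_iff]
    apply div_nonpos_of_nonpos_of_nonneg
    · simp
    · positivity
  have h3 : 0 ≤ t ^ (-((d : ℝ) / 2)) := by positivity
  calc _ ≤ t ^ (-((d : ℝ) / 2)) * 1 := by gcongr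
    _ = _ := mul_one _

@[fun_prop]
lemma measurable_heatKernel_uncurry {d : ℕ} :
    Measurable fun p : ℝ × EuclideanSpace ℝ (Fin d) => heatKernel p.1 p.2 := by
  unfold heatKernel
  fun_prop

lemma measurable_heatKernel {d : ℕ} (t : ℝ) :
    Measurable fun y : EuclideanSpace ℝ (Fin d) => heatKernel t y := by
  unfold heatKernel
  fun_prop

lemma integrable_heatKernel {d : ℕ} {t : ℝ} (ht : 0 < t) :
    Integrable (fun y : EuclideanSpace ℝ (Fin d) => heatKernel t y) volume := by
  have h := (GaussianFourier.integrable_cexp_neg_mul_sq_norm_add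
    (V := EuclideanSpace ℝ (Fin d)) (b := ((1 / (2 * t) : ℝ) : ℂ))
    (by rw [Complex.ofReal_re]; positivity) 0 0).norm
  refine (h.const_mul ((2 * Real.pi * t) ^ (-((d : ℝ) / 2)))).congr ?_
  refine Eventually.of_forall fun y => ?_
  simp only [heatKernel, Complex.norm_exp]
  congr 2
  norm_cast
  simp
  ring

lemma charFun_withDensity_heatKernel {d : ℕ} {t : ℝ} (ht : 0 < t)
    (ξ : EuclideanSpace ℝ (Fin d)) :
    charFun ((volume : Measure (EuclideanSpace ℝ (Fin d))).withDensity
      fun y => ENNReal.ofReal (heatKernel t y)) ξ = Complex.exp (-(t * ‖ξ‖ ^ 2) / 2) := by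
  have hpi := Real.pi_pos
  have hb : 0 < (((1 / (2 * t) : ℝ) : ℂ)).re := by rw [Complex.ofReal_re]; positivity
  rw [charFun_apply, integral_withDensity_eq_integral_toReal_smul
    (measurable_heatKernel t).ennreal_ofReal (by simp)]
  have key := GaussianFourier.integral_cexp_neg_mul_sq_norm_add hb Complex.I ξ
  have hc : ((2 * Real.pi * t : ℝ) : ℂ) ^ (((-((d : ℝ) / 2) : ℝ)) : ℂ) *
      (Real.pi / ((1 / (2 * t) : ℝ) : ℂ)) ^
        ((Module.finrank ℝ (EuclideanSpace ℝ (Fin d)) : ℂ) / 2) = 1 := by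
    have : (Real.pi / ((1 / (2 * t) : ℝ) : ℂ)) = ((2 * Real.pi * t : ℝ) : ℂ) := by
      push_cast
      field_simp
    rw [this, finrank_euclideanSpace_fin]
    have h2 : ((d : ℂ) / 2) = (((d : ℝ) / 2 : ℝ) : ℂ) := by push_cast; rfl
    rw [h2, ← Complex.ofReal_cpow (by positivity), ← Complex.ofReal_cpow (by positivity),
      ← Complex.ofReal_mul, ← Real.rpow_add (by positivity)]
    simp
  calc _ = ∫ y : EuclideanSpace ℝ (Fin d), ((2 * Real.pi * t : ℝ) : ℂ) ^
            (((-((d : ℝ) / 2) : ℝ)) : ℂ) * Complex.exp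
            (-((1 / (2 * t) : ℝ) : ℂ) * ‖y‖ ^ 2 + Complex.I * ⟪ξ, y⟫) := by
        congr 1
        ext y
        rw [ENNReal.toReal_ofReal (heatKernel_nonneg ht.le y), heatKernel, Complex.real_smul,
          Complex.ofReal_mul, Complex.ofReal_cpow (by positivity), mul_assoc, Complex.ofReal_exp,
          ← Complex.exp_add, real_inner_comm]
        congr 2
        push_cast
        ring
    _ = _ := by
        rw [integral_const_mul, key, ← mul_assoc, hc, one_mul, Complex.I_sq]
        congr 1
        have : (t : ℂ) ≠ 0 := by exact_mod_cast ht.ne'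
        push_cast
        field_simp
        ring

lemma multivariateGaussian_eq_withDensity {d : ℕ} {t : ℝ} (ht : 0 < t) :
    multivariateGaussian 0 (t • (1 : Matrix (Fin d) (Fin d) ℝ)) =
      volume.withDensity fun y => ENNReal.ofReal (heatKernel t y) := by
  have := isFiniteMeasure_withDensity_ofReal (integrable_heatKernel (d := d) ht).2
  refine Measure.ext_of_charFun ?_
  ext ξ
  rw [charFun_withDensity_heatKernel ht,
    charFun_multivariateGaussian (Matrix.PosSemidef.one.smul ht.le)]
  congr 1
  have h : (t : ℂ) * (‖ξ‖ : ℂ) ^ 2 = ∑ i, (ξ i : ℂ) * ((t : ℂ) * (ξ i : ℂ)) := by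
    rw [← Complex.ofReal_pow, EuclideanSpace.norm_sq_eq, Complex.ofReal_sum, Finset.mul_sum]
    refine Finset.sum_congr rfl fun i _ => ?_
    rw [Real.norm_eq_abs, sq_abs]
    push_cast
    ring
  rw [h]
  simp [Matrix.smul_mulVec, dotProduct, neg_div]

lemma lintegral_heatKernel {d : ℕ} {t : ℝ} (ht : 0 < t) :
    ∫⁻ y : EuclideanSpace ℝ (Fin d), ENNReal.ofReal (heatKernel t y) = 1 := by
  have h := measure_univ (μ := multivariateGaussian 0 (t • (1 : Matrix (Fin d) (Fin d) ℝ)))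
  rwa [multivariateGaussian_eq_withDensity ht, withDensity_apply _ .univ,
    Measure.restrict_univ] at h

/-- The constant `c = 2^(d/2-1) Γ(d/2-1) / (2π)^(d/2)` of the Newton kernel. -/
noncomputable def newtonConst (d : ℕ) : ℝ :=
  (2 : ℝ) ^ ((d : ℝ) / 2 - 1) * Real.Gamma ((d : ℝ) / 2 - 1) / (2 * Real.pi) ^ ((d : ℝ) / 2)

/-- The Newton kernel `c / |y|^(d-2)`, the Green function of Brownian motion in dimension `d ≥ 3`. It
takes the junk value `0` at the origin, where the Green function is infinite. -/
noncomputable def newtonKernel {d : ℕ} (y : EuclideanSpace ℝ (Fin d)) : ℝ :=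
  newtonConst d / ‖y‖ ^ (d - 2)

lemma newtonConst_pos {d : ℕ} (hd : 3 ≤ d) : 0 < newtonConst d := by
  have hd' : (3 : ℝ) ≤ d := by exact_mod_cast hd
  have := Real.pi_pos
  have := Real.Gamma_pos_of_pos (s := (d : ℝ) / 2 - 1) (by linarith)
  unfold newtonConst
  positivity

lemma newtonConst_sq (d : ℕ) (hd : 3 ≤ d) : newtonConst d ^ 2 =
    (2 : ℝ) ^ (d - 2) * Real.Gamma ((d : ℝ) / 2 - 1) ^ 2 / (2 * Real.pi) ^ d := by
  have hpi := Real.pi_pos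
  unfold newtonConst
  have h1 : ((2 : ℝ) ^ ((d : ℝ) / 2 - 1)) ^ 2 = (2 : ℝ) ^ (d - 2) := by
    rw [← Real.rpow_mul_natCast (by positivity), ← Real.rpow_natCast 2 (d - 2),
      Nat.cast_sub (by omega)]
    congr 1
    push_cast
    ring
  have h2 : ((2 * Real.pi) ^ ((d : ℝ) / 2)) ^ 2 = (2 * Real.pi) ^ d := by
    rw [← Real.rpow_mul_natCast (by positivity), ← Real.rpow_natCast _ d]
    congr 1
    push_cast
    ring
  rw [div_pow, mul_pow, h1, h2]

lemma newtonKernel_nonneg {d : ℕ} (hd : 3 ≤ d) (y : EuclideanSpace ℝ (Fin d)) :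
    0 ≤ newtonKernel y := by
  have := newtonConst_pos hd
  unfold newtonKernel
  positivity

@[fun_prop]
lemma measurable_newtonKernel {d : ℕ} :
    Measurable fun y : EuclideanSpace ℝ (Fin d) => newtonKernel y := by
  unfold newtonKernel
  fun_prop

/-- The substitution `t = 1/s` turns the time integral of the heat kernel into a Gamma integral. -/
lemma heatKernel_inv_subst {d : ℕ} {y : EuclideanSpace ℝ (Fin d)} {s : ℝ}
    (hs : 0 < s) :
    (|(-1 : ℝ)| * s ^ ((-1 : ℝ) - 1)) • heatKernel (s ^ (-1 : ℝ)) y =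
      (2 * Real.pi) ^ (-((d : ℝ) / 2)) *
        (s ^ ((d : ℝ) / 2 - 1 - 1) * Real.exp (-(‖y‖ ^ 2 / 2 * s))) := by
  have hpi := Real.pi_pos
  unfold heatKernel
  rw [Real.mul_rpow (by positivity) (by positivity), ← Real.rpow_mul hs.le, smul_eq_mul, abs_neg,
    abs_one, one_mul]
  have h1 : -(‖y‖ ^ 2) / (2 * s ^ (-1 : ℝ)) = -(‖y‖ ^ 2 / 2 * s) := by
    rw [Real.rpow_neg_one]
    field_simp
  have h2 : s ^ ((d : ℝ) / 2 - 1 - 1) = s ^ ((-1 : ℝ) - 1) * s ^ ((-1 : ℝ) * -((d : ℝ) / 2)) := by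
    rw [← Real.rpow_add hs]
    ring_nf
  rw [h1, h2]
  ring

lemma lintegral_heatKernel_time {d : ℕ} (hd : 3 ≤ d) {y : EuclideanSpace ℝ (Fin d)}
    (hy : y ≠ 0) :
    ∫⁻ t in Ioi (0 : ℝ), ENNReal.ofReal (heatKernel t y) = ENNReal.ofReal (newtonKernel y) := by
  have hpi := Real.pi_pos
  have hd' : (3 : ℝ) ≤ d := by exact_mod_cast hd
  have hr : 0 < ‖y‖ := norm_pos_iff.2 hy
  have ha : 0 < (d : ℝ) / 2 - 1 := by linarith
  have hint : IntegrableOn (fun t => heatKernel t y) (Ioi 0) := by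
    rw [← integrableOn_Ioi_comp_rpow_iff (fun t => heatKernel t y) (p := -1) (by norm_num)]
    refine IntegrableOn.congr_fun ?_ (fun s hs => (heatKernel_inv_subst hs).symm)
      measurableSet_Ioi
    refine Integrable.const_mul ?_ _
    have := integrableOn_rpow_mul_exp_neg_mul_rpow (p := 1) (s := (d : ℝ) / 2 - 1 - 1)
      (b := ‖y‖ ^ 2 / 2) (by linarith) one_pos (by positivity)
    simpa [IntegrableOn, neg_mul] using this
  have hval : ∫ t in Ioi (0 : ℝ), heatKernel t y = newtonKernel y := by
    rw [← integral_comp_rpow_Ioi (fun t => heatKernel t y) (p := -1) (by norm_num),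
      setIntegral_congr_fun measurableSet_Ioi (fun s hs => heatKernel_inv_subst hs),
      integral_const_mul, Real.integral_rpow_mul_exp_neg_mul_Ioi ha (by positivity), newtonKernel,
      newtonConst]
    have h1 : (1 / (‖y‖ ^ 2 / 2)) ^ ((d : ℝ) / 2 - 1) =
        (2 : ℝ) ^ ((d : ℝ) / 2 - 1) / ‖y‖ ^ (d - 2) := by
      rw [one_div_div, Real.div_rpow (by positivity) (by positivity), ← Real.rpow_natCast ‖y‖ 2,
        ← Real.rpow_mul hr.le, ← Real.rpow_natCast ‖y‖ (d - 2), Nat.cast_sub (by omega)]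
      congr 2
      push_cast
      ring
    rw [h1, Real.rpow_neg (by positivity)]
    field_simp
  rw [← hval, ofReal_integral_eq_lintegral_ofReal hint]
  filter_upwards [self_mem_ae_restrict measurableSet_Ioi] with t ht
    using heatKernel_nonneg (le_of_lt ht) y

/-! ### Potentials of nonnegative functions -/

/-- The potential `∫ g(x + y) K(y) dy` of `g` at `x`, where `K` is the Newton kernel. -/
noncomputable def potential {d : ℕ} (g : EuclideanSpace ℝ (Fin d) → ℝ≥0∞)
    (x : EuclideanSpace ℝ (Fin d)) : ℝ≥0∞ :=
  ∫⁻ y, g (x + y) * ENNReal.ofReal (newtonKernel y)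

@[fun_prop]
lemma measurable_potential {d : ℕ} {g : EuclideanSpace ℝ (Fin d) → ℝ≥0∞} (hg : Measurable g) :
    Measurable (potential g) := by
  unfold potential
  refine Measurable.lintegral_prod_right' (f := fun p : EuclideanSpace ℝ (Fin d) ×
    EuclideanSpace ℝ (Fin d) => g (p.1 + p.2) * ENNReal.ofReal (newtonKernel p.2)) ?_
  fun_prop

lemma lintegral_lintegral_heatKernel {d : ℕ} (hd : 3 ≤ d) {g : EuclideanSpace ℝ (Fin d) → ℝ≥0∞}
    (hg : Measurable g) (x : EuclideanSpace ℝ (Fin d)) :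
    ∫⁻ t in Ioi (0 : ℝ), ∫⁻ y, g (x + y) * ENNReal.ofReal (heatKernel t y) = potential g x := by
  have : Nonempty (Fin d) := ⟨⟨0, by omega⟩⟩
  rw [lintegral_lintegral_swap (by fun_prop), potential]
  refine lintegral_congr_ae ?_
  filter_upwards [Measure.ae_ne volume (0 : EuclideanSpace ℝ (Fin d))] with y hy
  rw [lintegral_const_mul _ (by fun_prop), lintegral_heatKernel_time hd hy]

/-- The potential of a bounded integrable function is bounded. The time integral is split at `t = 1`,
with `p_t * g ≤ M` before and `p_t * g ≤ t^(-d/2) ‖g‖₁` after. -/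
lemma exists_potential_le {d : ℕ} (hd : 3 ≤ d) {g : EuclideanSpace ℝ (Fin d) → ℝ≥0∞}
    (hg : Measurable g) {M : ℝ≥0∞} (hM : M ≠ ∞) (hgM : ∀ y, g y ≤ M) (hgi : ∫⁻ y, g y ≠ ∞) :
    ∃ C : ℝ≥0∞, C ≠ ∞ ∧ ∀ x, potential g x ≤ C := by
  have hd' : (3 : ℝ) ≤ d := by exact_mod_cast hd
  have hfin : ∫⁻ t in Ioi (1 : ℝ), ENNReal.ofReal (t ^ (-((d : ℝ) / 2))) ≠ ∞ :=
    ((integrableOn_Ioi_rpow_of_lt (a := -((d : ℝ) / 2)) (by linarith) one_pos).lintegral_lt_top).ne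
  refine ⟨M + (∫⁻ y, g y) * ∫⁻ t in Ioi (1 : ℝ), ENNReal.ofReal (t ^ (-((d : ℝ) / 2))),
    ENNReal.add_ne_top.2 ⟨hM, ENNReal.mul_ne_top hgi hfin⟩, fun x => ?_⟩
  rw [← lintegral_lintegral_heatKernel hd hg, ← Ioc_union_Ioi_eq_Ioi zero_le_one,
    lintegral_union measurableSet_Ioi (Set.Ioc_disjoint_Ioi le_rfl)]
  gcongr
  · calc _ ≤ ∫⁻ t in Ioc (0 : ℝ) 1, M := by
          refine setLIntegral_mono measurable_const fun t ht => ?_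
          calc _ ≤ ∫⁻ y : EuclideanSpace ℝ (Fin d), M * ENNReal.ofReal (heatKernel t y) := by
                gcongr with y
                exact hgM _
            _ = M := by
                rw [lintegral_const_mul _ (measurable_heatKernel t).ennreal_ofReal,
                  lintegral_heatKernel ht.1, mul_one]
      _ = M := by simp
  · rw [← lintegral_const_mul _ (by fun_prop)]
    refine setLIntegral_mono (by fun_prop) fun t ht => ?_
    rw [← lintegral_add_left_eq_self g x, ← lintegral_mul_const _ (by fun_prop)]
    gcongr with y
    exact heatKernel_le (zero_lt_one.trans ht) y

/-! ### Pathwise identities for integrals over a half-line -/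

/-- The square of an integral, split into the two triangles `s < t` and `t < s`. -/
lemma sq_lintegral_Ioi {h : ℝ → ℝ≥0∞} (hh : Measurable h) :
    (∫⁻ t in Ioi (0 : ℝ), h t) ^ 2 =
      2 * ∫⁻ s in Ioi (0 : ℝ), h s * ∫⁻ r in Ioi (0 : ℝ), h (s + r) := by
  set μ : Measure ℝ := volume.restrict (Ioi 0) with hμ
  have htail : ∀ s, 0 < s → ∫⁻ r in Ioi (0 : ℝ), h (s + r) = ∫⁻ t, (Ioi s).indicator h t ∂μ := by
    intro s hs
    rw [lintegral_indicator measurableSet_Ioi, hμ, Measure.restrict_restrict measurableSet_Ioi,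
      inter_eq_left.2 (Ioi_subset_Ioi hs.le), ← lintegral_indicator measurableSet_Ioi,
      ← lintegral_indicator measurableSet_Ioi, ← lintegral_add_left_eq_self ((Ioi s).indicator h) s]
    refine lintegral_congr fun r => ?_
    simp [indicator]
  have hm : Measurable fun p : ℝ × ℝ => (Ioi p.1).indicator h p.2 := by
    have : (fun p : ℝ × ℝ => (Ioi p.1).indicator h p.2) =
        {p : ℝ × ℝ | p.1 < p.2}.indicator fun p => h p.2 := by
      ext p
      simp [indicator]
    rw [this]
    exact (hh.comp measurable_snd).indicator (measurableSet_lt measurable_fst measurable_snd)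
  have hm' : Measurable fun p : ℝ × ℝ => (Iio p.1).indicator h p.2 := by
    have : (fun p : ℝ × ℝ => (Iio p.1).indicator h p.2) =
        {p : ℝ × ℝ | p.2 < p.1}.indicator fun p => h p.2 := by
      ext p
      simp [indicator]
    rw [this]
    exact (hh.comp measurable_snd).indicator (measurableSet_lt measurable_snd measurable_fst)
  have hsplit : ∀ s, ∫⁻ t, h t ∂μ =
      ∫⁻ t, (Ioi s).indicator h t ∂μ + ∫⁻ t, (Iio s).indicator h t ∂μ := by
    intro s
    rw [← lintegral_add_left (hh.indicator measurableSet_Ioi)]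
    refine lintegral_congr_ae ?_
    filter_upwards [Measure.ae_ne μ s] with t ht
    rcases lt_or_gt_of_ne ht with h1 | h1 <;> simp [indicator, h1, not_lt.2 h1.le]
  have hswap : ∫⁻ s, h s * ∫⁻ t, (Iio s).indicator h t ∂μ ∂μ =
      ∫⁻ s, h s * ∫⁻ t, (Ioi s).indicator h t ∂μ ∂μ := by
    simp_rw [← lintegral_const_mul _ (hh.indicator measurableSet_Iio)]
    rw [lintegral_lintegral_swap
      ((hh.comp measurable_fst).mul hm').aemeasurable]
    refine lintegral_congr fun t => ?_
    rw [← lintegral_const_mul _ (hh.indicator measurableSet_Ioi)]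
    refine lintegral_congr fun s => ?_
    by_cases hst : t < s <;> simp [indicator, hst, mul_comm]
  calc (∫⁻ t in Ioi (0 : ℝ), h t) ^ 2 = ∫⁻ s, h s * ∫⁻ t, h t ∂μ ∂μ := by
        rw [lintegral_mul_const _ hh, pow_two]
    _ = ∫⁻ s, (h s * ∫⁻ t, (Ioi s).indicator h t ∂μ + h s * ∫⁻ t, (Iio s).indicator h t ∂μ) ∂μ := by
        refine lintegral_congr fun s => ?_
        rw [← mul_add, ← hsplit]
    _ = 2 * ∫⁻ s, h s * ∫⁻ t, (Ioi s).indicator h t ∂μ ∂μ := by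
        have hm2 : Measurable fun s => h s * ∫⁻ t, (Ioi s).indicator h t ∂μ :=
          hh.mul hm.lintegral_prod_right'
        rw [lintegral_add_left hm2, hswap, two_mul]
    _ = _ := by
        congr 1
        refine setLIntegral_congr_fun measurableSet_Ioi fun s hs => ?_
        rw [htail s hs]

/-- The perpetual integral `∫₀^∞ g(B_t) dt` along the path of `ω`, with values in `ℝ≥0∞`. -/
noncomputable def occupation {Ω : Type*} {d : ℕ}
    (g : EuclideanSpace ℝ (Fin d) → ℝ≥0∞)
    (B : ℝ≥0 → Ω → EuclideanSpace ℝ (Fin d)) (ω : Ω) : ℝ≥0∞ :=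
  ∫⁻ t in Ioi (0 : ℝ), g (B t.toNNReal ω)

lemma occupation_eq_add {Ω : Type*} {d : ℕ}
    (g : EuclideanSpace ℝ (Fin d) → ℝ≥0∞)
    (B : ℝ≥0 → Ω → EuclideanSpace ℝ (Fin d)) (ω : Ω) {s : ℝ} (hs : 0 < s) :
    occupation g B ω = (∫⁻ t in Ioc 0 s, g (B t.toNNReal ω)) +
      ∫⁻ r in Ioi (0 : ℝ), g (B (s + r).toNNReal ω) := by
  have hunion : occupation g B ω = (∫⁻ t in Ioc 0 s, g (B t.toNNReal ω)) +
      ∫⁻ t in Ioi s, g (B t.toNNReal ω) := by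
    rw [← lintegral_union measurableSet_Ioi (Set.Ioc_disjoint_Ioi le_rfl),
      Ioc_union_Ioi_eq_Ioi hs.le, occupation]
  rw [hunion]
  congr 1
  rw [← lintegral_indicator measurableSet_Ioi, ← lintegral_indicator measurableSet_Ioi,
    ← lintegral_add_left_eq_self ((Ioi s).indicator _) s]
  refine lintegral_congr fun r => ?_
  simp [indicator]

/-! ### A jointly measurable modification -/

section BrownianMotion

variable {Ω : Type*} [MeasurableSpace Ω] {P : Measure Ω} {d : ℕ}
  {x : EuclideanSpace ℝ (Fin d)} {B B' : ℝ≥0 → Ω → EuclideanSpace ℝ (Fin d)}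
  {g h : EuclideanSpace ℝ (Fin d) → ℝ≥0∞}

lemma IsBrownianFrom.congr (hB : IsBrownianFrom B x P) (h : ∀ᵐ ω ∂P, ∀ t, B t ω = B' t ω) :
    IsBrownianFrom B' x P where
  start := by
    filter_upwards [hB.start, h] with ω h1 h2
    rw [← h2, h1]
  indep_increments n t ht := by
    refine (hB.indep_increments n t ht).congr fun i => ?_
    filter_upwards [h] with ω h2
    rw [h2, h2]
  law_increments s t hst := by
    refine (hB.law_increments s t hst).congr ?_
    filter_upwards [h] with ω h2
    rw [h2, h2]
  continuous_paths := by
    filter_upwards [hB.continuous_paths, h] with ω h1 h2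
    simpa only [← h2] using h1

lemma IsBrownianFrom.aemeasurable (hB : IsBrownianFrom B x P) (t : ℝ≥0) :
    AEMeasurable (B t) P := by
  refine ((hB.law_increments 0 t zero_le).aemeasurable.add_const x).congr ?_
  filter_upwards [hB.start] with ω hω
  rw [hω, sub_add_cancel]

/-- A Brownian motion is indistinguishable from one which is measurable at every time and has only
continuous paths: on a null set, the path is replaced by a constant one. -/
lemma IsBrownianFrom.exists_measurable_modification (hB : IsBrownianFrom B x P) :
    ∃ B' : ℝ≥0 → Ω → EuclideanSpace ℝ (Fin d), (∀ t, Measurable (B' t)) ∧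
      (∀ ω, Continuous fun t => B' t ω) ∧ ∀ᵐ ω ∂P, ∀ t, B t ω = B' t ω := by
  classical
  -- Off a suitable null set, `B` agrees at a countable dense set of times with measurable functions;
  -- by continuity, the measurability at those times passes to all times.
  obtain ⟨D, hDc, hDd⟩ := TopologicalSpace.exists_countable_dense ℝ≥0
  have hae : ∀ᵐ ω ∂P, (Continuous fun t => B t ω) ∧
      ∀ q ∈ D, B q ω = (hB.aemeasurable q).mk (B q) ω :=
    hB.continuous_paths.and ((ae_ball_iff hDc).2 fun q _ => (hB.aemeasurable q).ae_eq_mk)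
  obtain ⟨N, hN, hNm, hN0⟩ := exists_measurable_superset_of_null (ae_iff.1 hae)
  have hgood : ∀ ω ∉ N, (Continuous fun t => B t ω) ∧
      ∀ q ∈ D, B q ω = (hB.aemeasurable q).mk (B q) ω := by
    intro ω hω
    by_contra hcon
    exact hω (hN hcon)
  let B' : ℝ≥0 → Ω → EuclideanSpace ℝ (Fin d) := fun t => N.piecewise (fun _ => x) (B t)
  have hcont : ∀ ω, Continuous fun t => B' t ω := by
    intro ω
    by_cases hω : ω ∈ N
    · simpa [B', hω] using continuous_const
    · simpa [B', hω] using (hgood ω hω).1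
  have hD : ∀ q ∈ D, Measurable (B' q) := by
    intro q hq
    have : B' q = N.piecewise (fun _ => x) ((hB.aemeasurable q).mk (B q)) := by
      ext1 ω
      by_cases hω : ω ∈ N
      · simp [B', hω]
      · simp [B', hω, (hgood ω hω).2 q hq]
    rw [this]
    exact Measurable.piecewise hNm measurable_const (hB.aemeasurable q).measurable_mk
  refine ⟨B', fun t => ?_, hcont, ?_⟩
  · obtain ⟨u, hu, hut⟩ := mem_closure_iff_seq_limit.1 (hDd t)
    refine measurable_of_tendsto_metrizable (fun n => hD (u n) (hu n)) ?_
    exact tendsto_pi_nhds.2 fun ω => ((hcont ω).tendsto t).comp hut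
  · filter_upwards [measure_eq_zero_iff_ae_notMem.1 hN0] with ω hω t
    simp [B', hω]

/-! ### The Markov property and the moments of the occupation functional -/

lemma IsBrownianFrom.lintegral_eval (hB : IsBrownianFrom B x P) (hg : Measurable g) {t : ℝ≥0}
    (ht : 0 < t) :
    ∫⁻ ω, g (B t ω) ∂P = ∫⁻ y, g (x + y) * ENNReal.ofReal (heatKernel t y) := by
  have hlaw := hB.law_increments 0 t zero_le
  rw [NNReal.coe_zero, sub_zero, multivariateGaussian_eq_withDensity (by exact_mod_cast ht)] at hlaw
  calc _ = ∫⁻ ω, g (x + (B t ω - B 0 ω)) ∂P := by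
        refine lintegral_congr_ae ?_
        filter_upwards [hB.start] with ω hω
        rw [hω, add_sub_cancel]
    _ = _ := by
        rw [← lintegral_map' (f := fun y => g (x + y)) (by fun_prop) hlaw.aemeasurable,
          hlaw.map_eq, lintegral_withDensity_eq_lintegral_mul _ (by fun_prop) (by fun_prop)]
        simp [mul_comm]

/-- The joint law of `(B_s, B_{s+r})`, as an iterated integral against heat kernels. -/
lemma IsBrownianFrom.lintegral_eval_mul_eval [IsProbabilityMeasure P]
    (hB : IsBrownianFrom B x P) (hh : Measurable h)
    (hg : Measurable g) {s r : ℝ≥0} (hs : 0 < s) (hr : 0 < r) :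
    ∫⁻ ω, h (B s ω) * g (B (s + r) ω) ∂P = ∫⁻ y, h (x + y) *
      (∫⁻ z, g (x + y + z) * ENNReal.ofReal (heatKernel r z)) *
        ENNReal.ofReal (heatKernel s y) := by
  have hlaw := hB.law_increments 0 s zero_le
  have hlaw' := hB.law_increments s (s + r) le_self_add
  rw [NNReal.coe_zero, sub_zero, multivariateGaussian_eq_withDensity (by exact_mod_cast hs)] at hlaw
  rw [NNReal.coe_add, add_sub_cancel_left,
    multivariateGaussian_eq_withDensity (by exact_mod_cast hr)] at hlaw'
  have hind : IndepFun (fun ω => B s ω - B 0 ω) (fun ω => B (s + r) ω - B s ω) P :=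
    hB.indep_increments.indepFun_sub_sub zero_le le_self_add
  have hjoint := (indepFun_iff_map_prod_eq_prod_map_map hlaw.aemeasurable hlaw'.aemeasurable).1 hind
  calc _ = ∫⁻ ω, h (x + (B s ω - B 0 ω)) *
            g (x + (B s ω - B 0 ω) + (B (s + r) ω - B s ω)) ∂P := by
        refine lintegral_congr_ae ?_
        filter_upwards [hB.start] with ω hω
        rw [hω, add_sub_cancel, add_sub_cancel]
    _ = ∫⁻ p, h (x + p.1) * g (x + p.1 + p.2)
          ∂(P.map fun ω => (B s ω - B 0 ω, B (s + r) ω - B s ω)) := by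
        rw [lintegral_map' (f := fun p : EuclideanSpace ℝ (Fin d) × EuclideanSpace ℝ (Fin d) =>
          h (x + p.1) * g (x + p.1 + p.2)) (by fun_prop)
          (hlaw.aemeasurable.prodMk hlaw'.aemeasurable)]
    _ = _ := by
        have hm : Measurable fun y => ∫⁻ z, g (x + y + z) * ENNReal.ofReal (heatKernel r z) := by
          refine Measurable.lintegral_prod_right' (f := fun p : EuclideanSpace ℝ (Fin d) ×
            EuclideanSpace ℝ (Fin d) => g (x + p.1 + p.2) * ENNReal.ofReal (heatKernel r p.2)) ?_
          have := measurable_heatKernel (d := d) r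
          fun_prop
        have hk := measurable_heatKernel (d := d) r
        have inner : ∀ y, ∫⁻ z, h (x + y) * g (x + y + z)
            ∂(volume.withDensity fun z => ENNReal.ofReal (heatKernel r z)) =
            h (x + y) * ∫⁻ z, g (x + y + z) * ENNReal.ofReal (heatKernel r z) := by
          intro y
          rw [lintegral_const_mul _ (by fun_prop),
            lintegral_withDensity_eq_lintegral_mul _ (by fun_prop) (by fun_prop)]
          simp only [Pi.mul_apply, mul_comm]
        rw [hjoint, hlaw.map_eq, hlaw'.map_eq, lintegral_prod _ (by fun_prop)]
        simp only [inner]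
        rw [lintegral_withDensity_eq_lintegral_mul _ (measurable_heatKernel _).ennreal_ofReal
          (by fun_prop)]
        simp only [Pi.mul_apply, mul_comm]

lemma measurable_uncurry_toNNReal (hm : ∀ t, Measurable (B t))
    (hc : ∀ ω, Continuous fun t => B t ω) :
    Measurable fun p : ℝ × Ω => B p.1.toNNReal p.2 := by
  have := measurable_uncurry_of_continuous_of_measurable (u := B) hc hm
  exact this.comp (f := fun p : ℝ × Ω => (p.1.toNNReal, p.2)) (by fun_prop)

lemma measurable_occupation (hm : ∀ t, Measurable (B t))
    (hc : ∀ ω, Continuous fun t => B t ω) (hg : Measurable g) :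
    Measurable (occupation g B) := by
  have := measurable_uncurry_toNNReal hm hc
  exact Measurable.lintegral_prod_left' (f := fun p : ℝ × Ω => g (B p.1.toNNReal p.2))
    (hg.comp this)

lemma IsBrownianFrom.lintegral_occupation [IsProbabilityMeasure P] (hd : 3 ≤ d)
    (hB : IsBrownianFrom B x P) (hm : ∀ t, Measurable (B t))
    (hc : ∀ ω, Continuous fun t => B t ω) (hg : Measurable g) :
    ∫⁻ ω, occupation g B ω ∂P = potential g x := by
  have hu := measurable_uncurry_toNNReal hm hc
  unfold occupation
  rw [← lintegral_lintegral_heatKernel hd hg, lintegral_lintegral_swap]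
  · refine setLIntegral_congr_fun measurableSet_Ioi fun t ht => ?_
    have ht' : 0 < t := ht
    rw [hB.lintegral_eval hg (Real.toNNReal_pos.2 ht), Real.coe_toNNReal _ ht'.le]
  · exact (hg.comp (hu.comp measurable_swap)).aemeasurable

/-- The Markov property at time `s`, for the integral of `g` along the path after time `s`. -/
lemma IsBrownianFrom.lintegral_eval_mul_future [IsProbabilityMeasure P] (hd : 3 ≤ d)
    (hB : IsBrownianFrom B x P) (hm : ∀ t, Measurable (B t))
    (hc : ∀ ω, Continuous fun t => B t ω) (hh : Measurable h) (hg : Measurable g)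
    {s : ℝ} (hs : 0 < s) :
    ∫⁻ ω, h (B s.toNNReal ω) * (∫⁻ r in Ioi (0 : ℝ), g (B (s + r).toNNReal ω)) ∂P =
      ∫⁻ y, h (x + y) * potential g (x + y) * ENNReal.ofReal (heatKernel s y) := by
  have hu := measurable_uncurry_toNNReal hm hc
  have hu' : Measurable fun p : Ω × ℝ => B (s + p.2).toNNReal p.1 :=
    hu.comp (f := fun p : Ω × ℝ => (s + p.2, p.1)) (by fun_prop)
  calc _ = ∫⁻ ω, (∫⁻ r in Ioi (0 : ℝ), h (B s.toNNReal ω) * g (B (s + r).toNNReal ω)) ∂P := by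
        refine lintegral_congr fun ω => ?_
        exact (lintegral_const_mul (f := fun r => g (B (s + r).toNNReal ω)) _
          (hg.comp (hu'.comp measurable_prodMk_left))).symm
    _ = ∫⁻ r in Ioi (0 : ℝ), ∫⁻ ω, h (B s.toNNReal ω) * g (B (s + r).toNNReal ω) ∂P := by
        refine lintegral_lintegral_swap (Measurable.aemeasurable ?_)
        exact (hh.comp ((hm _).comp measurable_fst)).mul (hg.comp hu')
    _ = ∫⁻ r in Ioi (0 : ℝ), ∫⁻ y, h (x + y) *
          (∫⁻ z, g (x + y + z) * ENNReal.ofReal (heatKernel r z)) *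
            ENNReal.ofReal (heatKernel s y) := by
        refine setLIntegral_congr_fun measurableSet_Ioi fun r hr => ?_
        have hr' : 0 < r := hr
        simp only [Real.toNNReal_add hs.le hr'.le]
        rw [hB.lintegral_eval_mul_eval hh hg (Real.toNNReal_pos.2 hs) (Real.toNNReal_pos.2 hr),
          Real.coe_toNNReal _ hs.le, Real.coe_toNNReal _ hr'.le]
    _ = _ := by
        have hm3 : Measurable fun p : ℝ × EuclideanSpace ℝ (Fin d) =>
            ∫⁻ z, g (x + p.2 + z) * ENNReal.ofReal (heatKernel p.1 z) := by
          refine Measurable.lintegral_prod_right' (f := fun q : (ℝ × EuclideanSpace ℝ (Fin d)) ×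
            EuclideanSpace ℝ (Fin d) => g (x + q.1.2 + q.2) *
              ENNReal.ofReal (heatKernel q.1.1 q.2)) ?_
          have : Measurable fun q : (ℝ × EuclideanSpace ℝ (Fin d)) × EuclideanSpace ℝ (Fin d) =>
              heatKernel q.1.1 q.2 := measurable_heatKernel_uncurry.comp
                (f := fun q : (ℝ × EuclideanSpace ℝ (Fin d)) × EuclideanSpace ℝ (Fin d) =>
                  (q.1.1, q.2)) (by fun_prop)
          fun_prop
        have hk := measurable_heatKernel (d := d) s
        rw [lintegral_lintegral_swap (by fun_prop)]
        refine lintegral_congr fun y => ?_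
        have hm4 : Measurable fun r : ℝ =>
            ∫⁻ z, g (x + y + z) * ENNReal.ofReal (heatKernel r z) :=
          hm3.comp measurable_prodMk_right
        rw [lintegral_mul_const _ (by fun_prop), lintegral_const_mul _ hm4,
          lintegral_lintegral_heatKernel hd hg]

/-- The second moment formula: `E[(∫₀^∞ g(B_t) dt)²]` is twice the potential of `g · potential g`. -/
lemma IsBrownianFrom.lintegral_occupation_sq [IsProbabilityMeasure P] (hd : 3 ≤ d)
    (hB : IsBrownianFrom B x P) (hm : ∀ t, Measurable (B t))
    (hc : ∀ ω, Continuous fun t => B t ω) (hg : Measurable g) :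
    ∫⁻ ω, occupation g B ω ^ 2 ∂P = 2 * potential (fun y => g y * potential g y) x := by
  have hu := measurable_uncurry_toNNReal hm hc
  have hF : Measurable fun q : Ω × ℝ => g (B q.2.toNNReal q.1) *
      ∫⁻ r in Ioi (0 : ℝ), g (B (q.2 + r).toNNReal q.1) := by
    refine (hg.comp (hu.comp measurable_swap)).mul ?_
    refine Measurable.lintegral_prod_right' (f := fun p : (Ω × ℝ) × ℝ =>
      g (B (p.1.2 + p.2).toNNReal p.1.1)) ?_
    exact hg.comp (hu.comp (f := fun p : (Ω × ℝ) × ℝ => (p.1.2 + p.2, p.1.1)) (by fun_prop))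
  calc _ = ∫⁻ ω, 2 * (∫⁻ s in Ioi (0 : ℝ), g (B s.toNNReal ω) *
            (∫⁻ r in Ioi (0 : ℝ), g (B (s + r).toNNReal ω))) ∂P := by
        refine lintegral_congr fun ω => ?_
        exact sq_lintegral_Ioi (h := fun t => g (B t.toNNReal ω))
          (hg.comp (hu.comp measurable_prodMk_right))
    _ = 2 * ∫⁻ s in Ioi (0 : ℝ), ∫⁻ ω, g (B s.toNNReal ω) *
            (∫⁻ r in Ioi (0 : ℝ), g (B (s + r).toNNReal ω)) ∂P := by
        rw [lintegral_const_mul _ hF.lintegral_prod_right',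
          lintegral_lintegral_swap hF.aemeasurable]
    _ = _ := by
        rw [← lintegral_lintegral_heatKernel hd (by fun_prop)]
        congr 1
        refine setLIntegral_congr_fun measurableSet_Ioi fun s hs => ?_
        exact hB.lintegral_eval_mul_future hd hm hc hg hg hs

/-! ### Almost surely constant occupation functionals -/

/-- If the perpetual integral is a constant `c`, then its part after time `s` lies between `c - s M` and
`c`, and hence so does the potential, almost everywhere for the law of `B_s`. As this law has a positive
density, the bounds hold Lebesgue-almost everywhere. -/
lemma IsBrownianFrom.potential_ae_near_const [IsProbabilityMeasure P] (hd : 3 ≤ d)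
    (hB : IsBrownianFrom B x P) (hm : ∀ t, Measurable (B t))
    (hc : ∀ ω, Continuous fun t => B t ω) (hg : Measurable g) {M c : ℝ≥0∞}
    (hgM : ∀ y, g y ≤ M) (hconst : ∀ᵐ ω ∂P, occupation g B ω = c) {s : ℝ} (hs : 0 < s) :
    ∀ᵐ y, potential g (x + y) ≤ c ∧ c ≤ ENNReal.ofReal s * M + potential g (x + y) := by
  have hk := measurable_heatKernel (d := d) s
  have hs' : 0 < s.toNNReal := Real.toNNReal_pos.2 hs
  have key : ∀ S, MeasurableSet S →
      (∫⁻ y in S, potential g (x + y) * ENNReal.ofReal (heatKernel s y) ≤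
        ∫⁻ y in S, c * ENNReal.ofReal (heatKernel s y)) ∧
      (∫⁻ y in S, c * ENNReal.ofReal (heatKernel s y) ≤
        ∫⁻ y in S, (ENNReal.ofReal s * M + potential g (x + y)) *
          ENNReal.ofReal (heatKernel s y)) := by
    intro S hS
    -- Test with the event `B_s - x ∈ S`.
    let h : EuclideanSpace ℝ (Fin d) → ℝ≥0∞ := fun z => S.indicator 1 (z - x)
    have hh : Measurable h := (measurable_one.indicator hS).comp (by fun_prop)
    have hS' : ∀ F : EuclideanSpace ℝ (Fin d) → ℝ≥0∞,
        ∫⁻ y in S, F y * ENNReal.ofReal (heatKernel s y) =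
          ∫⁻ y, h (x + y) * F y * ENNReal.ofReal (heatKernel s y) := by
      intro F
      rw [← lintegral_indicator hS]
      refine lintegral_congr fun y => ?_
      by_cases hy : y ∈ S <;> simp [h, hy]
    have hfut := hB.lintegral_eval_mul_future hd hm hc hh hg hs
    have hev : ∀ C : ℝ≥0∞, ∫⁻ ω, h (B s.toNNReal ω) * C ∂P =
        ∫⁻ y in S, C * ENNReal.ofReal (heatKernel s y) := by
      intro C
      rw [hB.lintegral_eval (g := fun z => h z * C) (by fun_prop) hs', hS' fun _ => C,
        Real.coe_toNNReal _ hs.le]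
    constructor
    · rw [hS', ← hfut, ← hev]
      refine lintegral_mono_ae ?_
      filter_upwards [hconst] with ω hω
      rw [← hω, occupation_eq_add g B ω hs]
      gcongr
      exact le_add_self
    · have hsum : ∫⁻ y in S, (ENNReal.ofReal s * M + potential g (x + y)) *
          ENNReal.ofReal (heatKernel s y) =
          ∫⁻ ω, h (B s.toNNReal ω) * (ENNReal.ofReal s * M) ∂P +
            ∫⁻ ω, h (B s.toNNReal ω) *
              (∫⁻ r in Ioi (0 : ℝ), g (B (s + r).toNNReal ω)) ∂P := by
        rw [hev, hfut, ← hS' fun y => potential g (x + y), ← lintegral_add_left (by fun_prop)]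
        simp only [add_mul]
      have hhB : Measurable fun ω => h (B s.toNNReal ω) := hh.comp (hm _)
      rw [hsum, ← hev, ← lintegral_add_left (by fun_prop)]
      refine lintegral_mono_ae ?_
      filter_upwards [hconst] with ω hω
      rw [← mul_add, ← hω, occupation_eq_add g B ω hs]
      gcongr
      calc _ ≤ ∫⁻ _ in Ioc 0 s, M := lintegral_mono fun t => hgM _
        _ = _ := by simp [mul_comm]
  have h1 := ae_le_of_forall_setLIntegral_le_of_sigmaFinite (μ := volume)
    (f := fun y => potential g (x + y) * ENNReal.ofReal (heatKernel s y)) (by fun_prop)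
    fun S hS _ => (key S hS).1
  have h2 := ae_le_of_forall_setLIntegral_le_of_sigmaFinite (μ := volume)
    (f := fun y => c * ENNReal.ofReal (heatKernel s y)) (by fun_prop)
    fun S hS _ => (key S hS).2
  filter_upwards [h1, h2] with y hy1 hy2
  have hp : ENNReal.ofReal (heatKernel s y) ≠ 0 := by
    simpa using heatKernel_pos hs y
  exact ⟨(ENNReal.mul_le_mul_iff_left hp ENNReal.ofReal_ne_top).1 hy1,
    (ENNReal.mul_le_mul_iff_left hp ENNReal.ofReal_ne_top).1 hy2⟩

lemma IsBrownianFrom.potential_ae_const [IsProbabilityMeasure P] (hd : 3 ≤ d)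
    (hB : IsBrownianFrom B x P) (hm : ∀ t, Measurable (B t))
    (hc : ∀ ω, Continuous fun t => B t ω) (hg : Measurable g) {M c : ℝ≥0∞} (hM : M ≠ ∞)
    (hgM : ∀ y, g y ≤ M) (hconst : ∀ᵐ ω ∂P, occupation g B ω = c) :
    ∀ᵐ y, potential g (x + y) = c := by
  have hall : ∀ᵐ y, ∀ n : ℕ, potential g (x + y) ≤ c ∧
      c ≤ ENNReal.ofReal (1 / ((n : ℝ) + 1)) * M + potential g (x + y) :=
    ae_all_iff.2 fun n => hB.potential_ae_near_const hd hm hc hg hgM hconst (by positivity)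
  filter_upwards [hall] with y hy
  refine le_antisymm (hy 0).1 ?_
  have h0 : Tendsto (fun n : ℕ => ENNReal.ofReal (1 / ((n : ℝ) + 1)) * M + potential g (x + y))
      atTop (𝓝 (ENNReal.ofReal 0 * M + potential g (x + y))) := by
    refine Tendsto.add_const _ (ENNReal.Tendsto.mul_const ?_ (Or.inr hM))
    exact ENNReal.tendsto_ofReal tendsto_one_div_add_atTop_nhds_zero_nat
  have := ge_of_tendsto' h0 fun n => (hy n).2
  simpa using this

/-- The perpetual integral of a bounded function can be almost surely equal to a finite constant only if
the function vanishes almost everywhere. -/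
lemma IsBrownianFrom.ae_eq_zero_of_occupation_ae_const [IsProbabilityMeasure P] (hd : 3 ≤ d)
    (hB : IsBrownianFrom B x P) (hm : ∀ t, Measurable (B t))
    (hc : ∀ ω, Continuous fun t => B t ω) (hg : Measurable g) {M c : ℝ≥0∞} (hM : M ≠ ∞)
    (hgM : ∀ y, g y ≤ M) (hc' : c ≠ ∞) (hconst : ∀ᵐ ω ∂P, occupation g B ω = c) :
    g =ᵐ[volume] 0 := by
  have hu := measurable_uncurry_toNNReal hm hc
  have hpot := hB.potential_ae_const hd hm hc hg hM hgM hconst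
  have hfut := hB.lintegral_eval_mul_future hd hm hc (h := fun _ => 1) measurable_const hg one_pos
  have hc1 : ∫⁻ ω, (∫⁻ r in Ioi (0 : ℝ), g (B (1 + r).toNNReal ω)) ∂P = c := by
    simp only [one_mul] at hfut
    rw [hfut, lintegral_congr_ae (g := fun y => c * ENNReal.ofReal (heatKernel 1 y)),
      lintegral_const_mul _ (measurable_heatKernel 1).ennreal_ofReal,
      lintegral_heatKernel one_pos, mul_one]
    filter_upwards [hpot] with y hy
    rw [hy]
  have hm1 : Measurable fun ω => ∫⁻ t in Ioc (0 : ℝ) 1, g (B t.toNNReal ω) :=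
    Measurable.lintegral_prod_left' (f := fun p : ℝ × Ω => g (B p.1.toNNReal p.2)) (hg.comp hu)
  -- The part after time `1` has mean `c` already, which leaves nothing for the part before it.
  have hsplit : ∫⁻ ω, (∫⁻ t in Ioc (0 : ℝ) 1, g (B t.toNNReal ω)) ∂P + c = c := by
    conv_lhs => rw [← hc1]
    rw [← lintegral_add_left hm1, lintegral_congr_ae (g := fun _ => c)]
    · simp
    · filter_upwards [hconst] with ω hω
      rw [← occupation_eq_add g B ω one_pos, hω]
  have hzero : ∫⁻ ω, (∫⁻ t in Ioc (0 : ℝ) 1, g (B t.toNNReal ω)) ∂P = 0 :=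
    (ENNReal.add_left_inj hc').1 (hsplit.trans (zero_add c).symm)
  rw [lintegral_lintegral_swap (f := fun ω t => g (B (Real.toNNReal t) ω))
      (hg.comp (hu.comp measurable_swap)).aemeasurable,
    lintegral_eq_zero_iff (Measurable.lintegral_prod_right'
      (f := fun p : ℝ × Ω => g (B p.1.toNNReal p.2)) (hg.comp hu))] at hzero
  obtain ⟨t, ht, htz⟩ : ∃ t ∈ Ioc (0 : ℝ) 1, ∫⁻ ω, g (B t.toNNReal ω) ∂P = 0 := by
    have : NeBot (ae ((volume : Measure ℝ).restrict (Ioc 0 1))) := by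
      rw [ae_restrict_neBot]
      simp
    exact ((ae_restrict_mem measurableSet_Ioc).and hzero).exists
  rw [hB.lintegral_eval hg (Real.toNNReal_pos.2 ht.1), Real.coe_toNNReal _ ht.1.le,
    lintegral_eq_zero_iff (by have := measurable_heatKernel (d := d) t; fun_prop)] at htz
  have hxy : ∀ᵐ y, g (x + y) = 0 := by
    filter_upwards [htz] with y hy
    have := heatKernel_pos ht.1 y
    simpa [this, not_le.2 this] using hy
  have := (measurePreserving_add_left volume (-x)).quasiMeasurePreserving.ae hxy
  simp only [add_neg_cancel_left] at this
  exact this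

end BrownianMotion

/-! ### From extended nonnegative to real integrals -/

section Real

variable {d : ℕ} {f : EuclideanSpace ℝ (Fin d) → ℝ}

lemma perpetualIntegral_eq_toReal_occupation {Ω : Type*}
    {B : ℝ≥0 → Ω → EuclideanSpace ℝ (Fin d)} (hf : Continuous f) (hf0 : ∀ y, 0 ≤ f y) {ω : Ω}
    (hc : Continuous fun t => B t ω) :
    perpetualIntegral f B ω = (occupation (fun y => ENNReal.ofReal (f y)) B ω).toReal := by
  have hp : Continuous fun t : ℝ => f (B t.toNNReal ω) :=
    hf.comp (hc.comp continuous_real_toNNReal)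
  rw [perpetualIntegral, integral_eq_lintegral_of_nonneg_ae
    (Eventually.of_forall fun t => hf0 _) hp.aestronglyMeasurable, occupation]

lemma integrableOn_of_occupation_ne_top {Ω : Type*}
    {B : ℝ≥0 → Ω → EuclideanSpace ℝ (Fin d)} (hf : Continuous f) (hf0 : ∀ y, 0 ≤ f y) {ω : Ω}
    (hc : Continuous fun t => B t ω)
    (hω : occupation (fun y => ENNReal.ofReal (f y)) B ω ≠ ∞) :
    IntegrableOn (fun t : ℝ => f (B t.toNNReal ω)) (Ioi 0) volume := by
  have hp : Continuous fun t : ℝ => f (B t.toNNReal ω) :=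
    hf.comp (hc.comp continuous_real_toNNReal)
  exact (lintegral_ofReal_ne_top_iff_integrable hp.aestronglyMeasurable
    (Eventually.of_forall fun t => hf0 _)).1 hω

/-- Reads off the integrability and the Bochner integral of `F ≥ 0` from a finite value of the Lebesgue
integral of a positive multiple of `F`. -/
lemma integrable_and_integral_of_lintegral {α : Type*} [MeasurableSpace α] {μ : Measure α}
    {F : α → ℝ} (hF : Measurable F) (hF0 : ∀ a, 0 ≤ F a) {c : ℝ} (hc : 0 < c)
    {v : ℝ≥0∞} (hv : v ≠ ∞) (h : ∫⁻ a, ENNReal.ofReal (c * F a) ∂μ = v) :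
    Integrable F μ ∧ v.toReal = c * ∫ a, F a ∂μ := by
  have hcF : Measurable fun a => c * F a := hF.const_mul c
  have hcF0 : 0 ≤ᵐ[μ] fun a => c * F a :=
    Eventually.of_forall fun a => mul_nonneg hc.le (hF0 a)
  constructor
  · refine (integrable_const_mul_iff (IsUnit.mk0 c hc.ne') F).1 ?_
    refine (lintegral_ofReal_ne_top_iff_integrable hcF.aestronglyMeasurable hcF0).1 ?_
    rwa [h]
  · rw [← integral_const_mul, integral_eq_lintegral_of_nonneg_ae hcF0 hcF.aestronglyMeasurable, h]

lemma lintegral_eq_potential (hf0 : ∀ y, 0 ≤ f y)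
    (x : EuclideanSpace ℝ (Fin d)) :
    ∫⁻ y, ENNReal.ofReal (newtonConst d * (f (x + y) / ‖y‖ ^ (d - 2))) =
      potential (fun y => ENNReal.ofReal (f y)) x := by
  refine lintegral_congr fun y => ?_
  rw [← ENNReal.ofReal_mul (hf0 _), newtonKernel]
  congr 1
  ring

lemma lintegral_eq_potential_mul_potential (hd : 3 ≤ d) (hf : Measurable f) (hf0 : ∀ y, 0 ≤ f y)
    (x : EuclideanSpace ℝ (Fin d)) :
    ∫⁻ p : EuclideanSpace ℝ (Fin d) × EuclideanSpace ℝ (Fin d),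
      ENNReal.ofReal (newtonConst d ^ 2 *
        (f (x + p.1) * f (x + p.1 + p.2) / (‖p.1‖ ^ (d - 2) * ‖p.2‖ ^ (d - 2))))
        ∂(volume.prod volume) =
      potential (fun y => ENNReal.ofReal (f y) * potential (fun y => ENNReal.ofReal (f y)) y) x := by
  rw [lintegral_prod _ (by fun_prop), potential]
  refine lintegral_congr fun y => ?_
  rw [potential, mul_assoc, mul_comm _ (ENNReal.ofReal (newtonKernel y)), ← mul_assoc,
    ← lintegral_const_mul _ (by fun_prop)]
  refine lintegral_congr fun z => ?_
  rw [← ENNReal.ofReal_mul (hf0 _), ← ENNReal.ofReal_mul (hf0 _),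
    ← ENNReal.ofReal_mul (mul_nonneg (hf0 _) (newtonKernel_nonneg hd y)), newtonKernel,
    newtonKernel]
  congr 1
  ring

end Real

theorem theorem1 {Ω : Type*} [MeasurableSpace Ω] (P : Measure Ω) [IsProbabilityMeasure P]
    (d : ℕ) (hd : 3 ≤ d) (x : EuclideanSpace ℝ (Fin d))
    (B : ℝ≥0 → Ω → EuclideanSpace ℝ (Fin d)) (hB : IsBrownianFrom B x P)
    (f : EuclideanSpace ℝ (Fin d) → ℝ) (hf : IsCL f) (hf0 : ∀ y, 0 ≤ f y) :
    -- the perpetual integral exists almost surely, and is square integrable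
    (∀ᵐ ω ∂P, IntegrableOn (fun t : ℝ => f (B t.toNNReal ω)) (Set.Ioi 0) volume) ∧
    MemLp (perpetualIntegral f B) 2 P ∧
    -- the potentials on the right-hand sides converge
    Integrable (fun y : EuclideanSpace ℝ (Fin d) => f (x + y) / ‖y‖ ^ (d - 2)) volume ∧
    Integrable (fun p : EuclideanSpace ℝ (Fin d) × EuclideanSpace ℝ (Fin d) =>
      f (x + p.1) * f (x + p.1 + p.2) / (‖p.1‖ ^ (d - 2) * ‖p.2‖ ^ (d - 2)))
      (volume.prod volume) ∧
    -- the expectation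
    ∫ ω, perpetualIntegral f B ω ∂P =
      (2 : ℝ) ^ ((d : ℝ) / 2 - 1) * Real.Gamma ((d : ℝ) / 2 - 1)
          / (2 * Real.pi) ^ ((d : ℝ) / 2) *
        ∫ y : EuclideanSpace ℝ (Fin d), f (x + y) / ‖y‖ ^ (d - 2) ∧
    -- the variance
    ∫ ω, (perpetualIntegral f B ω - ∫ ω', perpetualIntegral f B ω' ∂P) ^ 2 ∂P =
      (2 : ℝ) ^ (d - 2) * Real.Gamma ((d : ℝ) / 2 - 1) ^ 2 / (2 * Real.pi) ^ d *
        (2 * (∫ z : EuclideanSpace ℝ (Fin d), ∫ y : EuclideanSpace ℝ (Fin d),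
            f (x + y) * f (x + y + z) / (‖y‖ ^ (d - 2) * ‖z‖ ^ (d - 2)))
          - (∫ y : EuclideanSpace ℝ (Fin d), f (x + y) / ‖y‖ ^ (d - 2)) ^ 2) ∧
    -- for `f ≠ 0` the functional is not almost surely constant, and the variance is positive
    (f ≠ 0 →
      (¬ ∃ c : ℝ, ∀ᵐ ω ∂P, perpetualIntegral f B ω = c) ∧
      0 < (2 : ℝ) ^ (d - 2) * Real.Gamma ((d : ℝ) / 2 - 1) ^ 2 / (2 * Real.pi) ^ d *
        (2 * (∫ z : EuclideanSpace ℝ (Fin d), ∫ y : EuclideanSpace ℝ (Fin d),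
            f (x + y) * f (x + y + z) / (‖y‖ ^ (d - 2) * ‖z‖ ^ (d - 2)))
          - (∫ y : EuclideanSpace ℝ (Fin d), f (x + y) / ‖y‖ ^ (d - 2)) ^ 2)) := by
  obtain ⟨B', hm, hc, hBB'⟩ := hB.exists_measurable_modification
  have hB' := hB.congr hBB'
  have hfm : Measurable f := hf.continuous.measurable
  set g : EuclideanSpace ℝ (Fin d) → ℝ≥0∞ := fun y => ENNReal.ofReal (f y) with hg_def
  have hg : Measurable g := hfm.ennreal_ofReal
  obtain ⟨C, hC⟩ := hf.bounded
  have hgM : ∀ y, g y ≤ ENNReal.ofReal C := fun y =>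
    ENNReal.ofReal_le_ofReal ((le_abs_self _).trans (hC y))
  have hgi : ∫⁻ y, g y ≠ ∞ := hf.integrable.lintegral_lt_top.ne
  obtain ⟨U, hU, hpU⟩ := exists_potential_le hd hg ENNReal.ofReal_ne_top hgM hgi
  have hu1 : potential g x ≠ ∞ := ((hpU x).trans_lt hU.lt_top).ne
  have hu2 : potential (fun y => g y * potential g y) x ≠ ∞ := by
    refine ne_top_of_le_ne_top (ENNReal.mul_ne_top hU hu1) ?_
    calc potential (fun y => g y * potential g y) x
        ≤ ∫⁻ y, U * (g (x + y) * ENNReal.ofReal (newtonKernel y)) := by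
          refine lintegral_mono fun y => ?_
          calc g (x + y) * potential g (x + y) * ENNReal.ofReal (newtonKernel y)
              ≤ g (x + y) * U * ENNReal.ofReal (newtonKernel y) := by
                gcongr
                exact hpU _
            _ = _ := by ring
      _ = U * potential g x := by rw [lintegral_const_mul _ (by fun_prop), potential]
  set J : Ω → ℝ≥0∞ := occupation g B' with hJ_def
  have hJm : Measurable J := measurable_occupation hm hc hg
  have hJ1 : ∫⁻ ω, J ω ∂P = potential g x := hB'.lintegral_occupation hd hm hc hg
  have hJ2 : ∫⁻ ω, J ω ^ 2 ∂P = 2 * potential (fun y => g y * potential g y) x :=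
    hB'.lintegral_occupation_sq hd hm hc hg
  have hJfin : ∀ᵐ ω ∂P, J ω ≠ ∞ := by
    filter_upwards [ae_lt_top hJm (by rwa [hJ1])] with ω hω using hω.ne
  have hI : perpetualIntegral f B =ᵐ[P] fun ω => (J ω).toReal := by
    filter_upwards [hBB'] with ω hω
    rw [← perpetualIntegral_eq_toReal_occupation hf.continuous hf0 (hc ω)]
    simp only [perpetualIntegral, hω]
  have hmem : MemLp (perpetualIntegral f B) 2 P := by
    refine MemLp.ae_eq hI.symm ?_
    rw [memLp_two_iff_integrable_sq hJm.ennreal_toReal.aestronglyMeasurable]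
    have := integrable_toReal_of_lintegral_ne_top (μ := P) (hJm.pow_const 2).aemeasurable
      (by rw [hJ2]; exact ENNReal.mul_ne_top (by simp) hu2)
    simpa [ENNReal.toReal_pow] using this
  obtain ⟨hint1, hval1⟩ := integrable_and_integral_of_lintegral
    (F := fun y => f (x + y) / ‖y‖ ^ (d - 2)) (by fun_prop)
    (fun y => div_nonneg (hf0 _) (by positivity)) (newtonConst_pos hd) hu1
    (lintegral_eq_potential hf0 x)
  obtain ⟨hint2, hval2⟩ := integrable_and_integral_of_lintegral
    (F := fun p : EuclideanSpace ℝ (Fin d) × EuclideanSpace ℝ (Fin d) =>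
      f (x + p.1) * f (x + p.1 + p.2) / (‖p.1‖ ^ (d - 2) * ‖p.2‖ ^ (d - 2))) (by fun_prop)
    (fun p => div_nonneg (mul_nonneg (hf0 _) (hf0 _)) (by positivity))
    (pow_pos (newtonConst_pos hd) 2) hu2 (lintegral_eq_potential_mul_potential hd hfm hf0 x)
  rw [integral_prod_symm _ hint2] at hval2
  have hmean : ∫ ω, perpetualIntegral f B ω ∂P =
      newtonConst d * ∫ y : EuclideanSpace ℝ (Fin d), f (x + y) / ‖y‖ ^ (d - 2) := by
    rw [← hval1, ← hJ1, integral_congr_ae hI, integral_toReal hJm.aemeasurable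
      (hJfin.mono fun ω h => h.lt_top)]
  have hsecond : ∫ ω, perpetualIntegral f B ω ^ 2 ∂P = newtonConst d ^ 2 *
      (2 * ∫ z : EuclideanSpace ℝ (Fin d), ∫ y : EuclideanSpace ℝ (Fin d),
            f (x + y) * f (x + y + z) / (‖y‖ ^ (d - 2) * ‖z‖ ^ (d - 2))) := by
    have hI2 : (fun ω => perpetualIntegral f B ω ^ 2) =ᵐ[P] fun ω => (J ω ^ 2).toReal := by
      filter_upwards [hI] with ω hω
      rw [hω, ENNReal.toReal_pow]
    rw [integral_congr_ae hI2, integral_toReal (hJm.pow_const 2).aemeasurable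
      (hJfin.mono fun ω h => ENNReal.pow_lt_top h.lt_top), hJ2, ENNReal.toReal_mul, hval2,
      ENNReal.toReal_ofNat]
    ring
  have hvar : ∫ ω, (perpetualIntegral f B ω - ∫ ω', perpetualIntegral f B ω' ∂P) ^ 2 ∂P =
      (2 : ℝ) ^ (d - 2) * Real.Gamma ((d : ℝ) / 2 - 1) ^ 2 / (2 * Real.pi) ^ d *
        (2 * (∫ z : EuclideanSpace ℝ (Fin d), ∫ y : EuclideanSpace ℝ (Fin d),
            f (x + y) * f (x + y + z) / (‖y‖ ^ (d - 2) * ‖z‖ ^ (d - 2)))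
          - (∫ y : EuclideanSpace ℝ (Fin d), f (x + y) / ‖y‖ ^ (d - 2)) ^ 2) := by
    rw [← variance_eq_integral hmem.aemeasurable, variance_eq_sub hmem]
    simp only [Pi.pow_apply]
    rw [hsecond, hmean, ← newtonConst_sq d hd]
    ring
  have hnonconst : f ≠ 0 → ¬ ∃ c : ℝ, ∀ᵐ ω ∂P, perpetualIntegral f B ω = c := by
    rintro hne ⟨c, hconst⟩
    have hJc : ∀ᵐ ω ∂P, J ω = ENNReal.ofReal c := by
      filter_upwards [hconst, hI, hJfin] with ω h1 h2 h3
      rw [← h1, h2, ENNReal.ofReal_toReal h3]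
    have hg0 := hB'.ae_eq_zero_of_occupation_ae_const hd hm hc hg ENNReal.ofReal_ne_top hgM
      ENNReal.ofReal_ne_top hJc
    refine hne ((hf.continuous.ae_eq_iff_eq volume continuous_zero).1 ?_)
    filter_upwards [hg0] with y hy
    exact le_antisymm (ENNReal.ofReal_eq_zero.1 hy) (hf0 y)
  refine ⟨?_, hmem, hint1, hint2, hmean, hvar, fun hne => ⟨hnonconst hne, ?_⟩⟩
  · filter_upwards [hBB', hJfin] with ω h1 h2
    simpa only [h1] using integrableOn_of_occupation_ne_top hf.continuous hf0 (hc ω) h2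
  -- A vanishing variance would make the functional almost surely equal to its mean.
  · rw [← hvar]
    refine lt_of_le_of_ne (integral_nonneg fun ω => sq_nonneg _) fun h0 => hnonconst hne ?_
    refine ⟨∫ ω', perpetualIntegral f B ω' ∂P, ?_⟩
    have hsq := (integral_eq_zero_iff_of_nonneg (fun ω => sq_nonneg _)
      (hmem.sub (memLp_const _)).integrable_sq).1 h0.symm
    filter_upwards [hsq] with ω hω
    exact sub_eq_zero.1 (pow_eq_zero_iff two_ne_zero |>.1 hω)
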